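/- Let $H$ be a complex Hilbert space with scalar product $(\cdot,\cdot)$ (conjugate-linear in the second argument), let $\{U(t)\}_{t\ge 0}$ be a strongly continuous semigroup of bounded linear operators on $H$, and let $L$ be its generator, $Lx=\lim_{h\searrow 0}\frac1h[U(h)x-x]$ on the domain $D(L)$ of all $x$ for which the limit exists; let $L^\dagger$ be the adjoint of $L$. Let $z\in D(L^\dagger)$ with $z\neq 0$, and put $Px=(x,z)(z,z)^{-1}z$ and $Q=1-P$. Then: (i) For every $x\in H$ the Volterra equation $$f(x,t)=(U(t)Qx,QL^\dagger z)(z,z)^{-1}-\int_0^t f(x,t-s)\,(U(s)z,QL^\dagger z)(z,z)^{-1}\,ds,\qquad t\ge 0,$$ has a unique continuous solution $f(x,\cdot):[0,\infty)\to\mathbb{C}$. Define $$u(x,t)=Px+U(t)Qx-\int_0^t f(x,t-s)\,U(s)z\,ds,\qquad x\in H,\ t\ge 0.$$ (ii) The operator $QL$ (with domain $D(L)$) is closable, and $\overline{QL}\,Q=QLQ$ as unbounded operators, i.e. with equal domains $\{x: Qx\in D(\overline{QL})\}=\{x: Qx\in D(L)\}$ and equal values; in particular $QLQ$ is closed. (iii)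 The maps $G(t):=u(\cdot,t)$, $t\ge 0$, are bounded linear operators on $H$ and form a strongly continuous semigroup, whose generator is $\overline{QL}\,Q=QLQ$. -/

import Mathlib

open Filter Topology Set

namespace Mori

variable {H : Type*} [NormedAddCommGroup H] [InnerProductSpace ℂ H]

/-- A strongly continuous (C0) semigroup of bounded linear operators on `H`.  Only the values
`T t` with `0 ≤ t` matter. -/
structure IsC0Semigroup (T : ℝ → H →L[ℂ] H) : Prop where
  map_zero : T 0 = 1
  map_add : ∀ s t : ℝ, 0 ≤ s → 0 ≤ t → T (s + t) = T s * T t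
  continuousOn : ∀ x : H, ContinuousOn (fun t => T t x) (Ici 0)

/-- `x` lies in the domain of the generator of `T`, with value `y`: the difference quotient
`(T h x - x) / h` converges to `y` as `h ↘ 0`. -/
def HasGeneratorValue (T : ℝ → H →L[ℂ] H) (x y : H) : Prop :=
  Tendsto (fun h : ℝ => ((h : ℂ)⁻¹) • (T h x - x)) (𝓝[>] 0) (𝓝 y)

theorem HasGeneratorValue.add {T : ℝ → H →L[ℂ] H} {x y x' y' : H}
    (h : HasGeneratorValue T x y) (h' : HasGeneratorValue T x' y') :
    HasGeneratorValue T (x + x') (y + y') := by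
  refine (Tendsto.add h h').congr fun r => ?_
  rw [map_add, ← smul_add]
  congr 1
  abel

theorem HasGeneratorValue.smul {T : ℝ → H →L[ℂ] H} {x y : H} (c : ℂ)
    (h : HasGeneratorValue T x y) : HasGeneratorValue T (c • x) (c • y) := by
  refine (Tendsto.const_smul h c).congr fun r => ?_
  rw [map_smul, ← smul_sub, smul_comm]

theorem HasGeneratorValue.zero (T : ℝ → H →L[ℂ] H) : HasGeneratorValue T 0 0 := by
  simp [HasGeneratorValue]

theorem HasGeneratorValue.unique {T : ℝ → H →L[ℂ] H} {x y y' : H}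
    (h : HasGeneratorValue T x y) (h' : HasGeneratorValue T x y') : y = y' :=
  tendsto_nhds_unique h h'

/-- The (generally unbounded) generator of `T`: `x ↦ lim_{h ↘ 0} (T h x - x) / h`, on the domain
of all `x` for which the limit exists. -/
noncomputable def generator (T : ℝ → H →L[ℂ] H) : H →ₗ.[ℂ] H where
  domain :=
    { carrier := {x | ∃ y, HasGeneratorValue T x y}
      add_mem' := fun ⟨_, h⟩ ⟨_, h'⟩ => ⟨_, h.add h'⟩
      zero_mem' := ⟨0, HasGeneratorValue.zero T⟩
      smul_mem' := fun c _ ⟨_, h⟩ => ⟨_, h.smul c⟩ }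
  toFun :=
    { toFun := fun x => x.2.choose
      map_add' := fun x x' =>
        (x + x').2.choose_spec.unique (x.2.choose_spec.add x'.2.choose_spec)
      map_smul' := fun c x => (c • x).2.choose_spec.unique (x.2.choose_spec.smul c) }

/-- The composition `A B` of an unbounded operator `A` with an everywhere defined bounded operator
`B`, on its natural domain `{x | B x ∈ D(A)}`.  (The composition `B A`, on `D(A)`, is
`LinearMap.compPMap`.) -/
def precomp (A : H →ₗ.[ℂ] H) (B : H →L[ℂ] H) : H →ₗ.[ℂ] H where
  domain := A.domain.comap (B : H →ₗ[ℂ] H)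
  toFun :=
    { toFun := fun x => A ⟨B x, x.2⟩
      map_add' := fun x y => by
        rw [← LinearPMap.map_add]
        congr 1
        exact Subtype.ext (B.map_add x y)
      map_smul' := fun c x => by
        rw [RingHom.id_apply, ← LinearPMap.map_smul]
        congr 1
        exact Subtype.ext (B.map_smul c x) }

/-- The composition `B A` of a bounded operator `B` with an unbounded operator `A`, on `D(A)`. -/
def postcomp (B : H →L[ℂ] H) (A : H →ₗ.[ℂ] H) : H →ₗ.[ℂ] H :=
  (B : H →ₗ[ℂ] H).compPMap A

/-- The Mori projection `P x = (x, z) (z, z)⁻¹ z`, where `(x, y) = inner ℂ y x` is the scalar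
product with complex conjugation in the second argument. -/
noncomputable def P (z : H) : H →L[ℂ] H :=
  (inner ℂ z z : ℂ)⁻¹ • (innerSL ℂ z).smulRight z

/-- The complementary projection `Q = 1 - P`. -/
noncomputable def Q (z : H) : H →L[ℂ] H := 1 - P z

/-- `f : [0, ∞) → ℂ` is a continuous solution of the Volterra equation
`f t = (U t (Q x), Q w) (z, z)⁻¹ - ∫₀ᵗ f (t - s) (U s z, Q w) (z, z)⁻¹ ds`, `t ≥ 0`.
It is used with `w` the value at `z` of the adjoint of the generator of `U`. -/
def IsVolterraSolution (U : ℝ → H →L[ℂ] H) (z w x : H) (f : ℝ → ℂ) : Prop :=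
  ContinuousOn f (Ici 0) ∧
    ∀ t : ℝ, 0 ≤ t →
      f t = inner ℂ (Q z w) (U t (Q z x)) * (inner ℂ z z)⁻¹
        - ∫ s in (0 : ℝ)..t, f (t - s) * (inner ℂ (Q z w) (U s z) * (inner ℂ z z)⁻¹)

/-- `u(x, t) = P x + U t (Q x) - ∫₀ᵗ f (t - s) U s z ds`. -/
noncomputable def orbit (U : ℝ → H →L[ℂ] H) (z x : H) (f : ℝ → ℂ) (t : ℝ) : H :=
  P z x + U t (Q z x) - ∫ s in (0 : ℝ)..t, f (t - s) • U s z

end Mori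

/-! Write `⟨a, b⟩` for `inner ℂ a b` and `w = L†z`. Because `z ∈ D(L†)`, `PLx = (z,z)⁻¹⟨w, x⟩ z` on
`D(L)`, so `QL` is `L` minus a bounded operator and is already closed. The closure therefore changes
nothing, and the operator identity is just `(QL)Q = Q(LQ)`.

For the semigroup, put `Bx = (z,z)⁻¹⟨Qw, x⟩ z`; on `D(L) ∩ ran Q` the operator `L - B` agrees with
`QL`. Since `B` has rank one, the Duhamel equation for the semigroup `V` of `L - B` reduces to a
scalar Volterra equation (`exists_rankOne_perturbation`). A linear scalar equation for `⟨z, V(t)Qx⟩`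
shows that `V` preserves `ran Q`. Then `G = P + VQ` is a semigroup, frozen on `ran P`, and its
generator is `(L - B)Q = QLQ` (`exists_orbit_semigroup`). -/

namespace Mori

/-! ### Convolutions and short-time averages. -/

section Convolution

variable {E : Type*} [NormedAddCommGroup E] [NormedSpace ℂ E]

theorem continuous_convolution {f : ℝ → ℂ} {g : ℝ → E} (hf : Continuous f) (hg : Continuous g) :
    Continuous fun t : ℝ => ∫ s in (0 : ℝ)..t, f (t - s) • g s := by
  apply intervalIntegral.continuous_parametric_intervalIntegral_of_continuous
    (f := fun t s : ℝ => f (t - s) • g s)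
  · simp only [Function.uncurry_def]
    fun_prop
  · exact continuous_id

/-- The substitution `s = h r` moves `h` into the integrand over the fixed interval `[0, 1]`, where
continuity in the parameter applies. -/
theorem tendsto_average {Φ : ℝ → ℝ → E} [CompleteSpace E] (hΦ : Continuous (Function.uncurry Φ)) :
    Tendsto (fun h : ℝ => ((h : ℂ)⁻¹) • ∫ s in (0 : ℝ)..h, Φ h s) (𝓝[>] 0) (𝓝 (Φ 0 0)) := by
  have hcont : Continuous fun h : ℝ => ∫ r in (0 : ℝ)..1, Φ h (h * r) :=
    intervalIntegral.continuous_parametric_intervalIntegral_of_continuous'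
      (f := fun h r : ℝ => Φ h (h * r))
      (hΦ.comp (by fun_prop : Continuous fun p : ℝ × ℝ => (p.1, p.1 * p.2))) 0 1
  have h0 : Tendsto (fun h : ℝ => ∫ r in (0 : ℝ)..1, Φ h (h * r)) (𝓝[>] 0) (𝓝 (Φ 0 0)) := by
    have := hcont.tendsto 0
    simp only [zero_mul, intervalIntegral.integral_const, sub_zero, one_smul] at this
    exact this.mono_left nhdsWithin_le_nhds
  refine h0.congr' ?_
  filter_upwards [self_mem_nhdsWithin] with h hh
  rw [intervalIntegral.integral_comp_mul_left (fun s => Φ h s) (ne_of_gt hh)]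
  simp only [mul_zero, mul_one, ← Complex.ofReal_inv]
  rw [RCLike.real_smul_eq_coe_smul (K := ℂ)]
  rfl

end Convolution

/-! ### Scalar Volterra equations: a priori bound, uniqueness, existence. -/

section Volterra

/-- A continuous function dominated by a constant plus a multiple of its primitive is bounded on
compact intervals by a multiple of that constant. -/
theorem norm_le_of_le_add_integral {f : ℝ → ℂ} (hf : Continuous f) {T K M : ℝ}
    (hM : 0 < M) (h : ∀ t ∈ Icc 0 T, ‖f t‖ ≤ K + M * ∫ s in (0 : ℝ)..t, ‖f s‖) :
    ∀ t ∈ Icc 0 T, ‖f t‖ ≤ 2 * K * Real.exp (2 * M * T) := by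
  intro t ht
  have hT : 0 ≤ T := ht.1.trans ht.2
  have hK : 0 ≤ K := by
    have := (norm_nonneg _).trans (h 0 ⟨le_rfl, hT⟩)
    simpa using this
  -- The weight has rate `2M`, twice the kernel bound, so that at the maximum the integral term
  -- contributes only `S / 2` and can be absorbed.
  obtain ⟨r, hr, hmax⟩ := isCompact_Icc.exists_isMaxOn (nonempty_Icc.2 hT)
    (f := fun t => Real.exp (-(2 * M * t)) * ‖f t‖) (by fun_prop)
  set S := Real.exp (-(2 * M * r)) * ‖f r‖ with hS
  have hS0 : 0 ≤ S := by positivity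
  have hle : ∀ s ∈ Icc 0 T, ‖f s‖ ≤ S * Real.exp (2 * M * s) := by
    intro s hs
    have h1 : Real.exp (-(2 * M * s)) * ‖f s‖ ≤ S := hmax hs
    calc ‖f s‖ = Real.exp (-(2 * M * s)) * ‖f s‖ * Real.exp (2 * M * s) := by
          rw [mul_right_comm, ← Real.exp_add]; simp
      _ ≤ _ := by gcongr
  have hint : ∫ s in (0 : ℝ)..r, ‖f s‖ ≤ S * (Real.exp (2 * M * r) / (2 * M)) := by
    calc ∫ s in (0 : ℝ)..r, ‖f s‖ ≤ ∫ s in (0 : ℝ)..r, S * Real.exp (2 * M * s) := by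
          apply intervalIntegral.integral_mono_on hr.1
          · exact hf.norm.intervalIntegrable _ _
          · exact (by fun_prop : Continuous fun s => S * Real.exp (2 * M * s)).intervalIntegrable _ _
          · intro s hs
            exact hle s ⟨hs.1, hs.2.trans hr.2⟩
      _ = S * ((Real.exp (2 * M * r) - 1) / (2 * M)) := by
          rw [intervalIntegral.integral_const_mul,
            intervalIntegral.integral_comp_mul_left (fun s => Real.exp s) (by positivity)]
          simp [integral_exp]
          ring_nf
          tauto
      _ ≤ _ := by gcongr; linarith
  have hSK : S ≤ 2 * K := by
    have h1 : S ≤ Real.exp (-(2 * M * r)) * (K + M * (S * (Real.exp (2 * M * r) / (2 * M)))) := by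
      rw [hS]
      gcongr
      exact (h r hr).trans (by gcongr)
    have h2 : Real.exp (-(2 * M * r)) * (K + M * (S * (Real.exp (2 * M * r) / (2 * M))))
        = Real.exp (-(2 * M * r)) * K + S / 2 := by
      rw [Real.exp_neg]
      field_simp
    have h3 : Real.exp (-(2 * M * r)) * K ≤ K := by
      apply mul_le_of_le_one_left hK
      rw [Real.exp_le_one_iff]
      nlinarith [hr.1]
    linarith
  calc ‖f t‖ ≤ S * Real.exp (2 * M * t) := hle t ht
    _ ≤ _ := by gcongr; exact ht.2

theorem exists_pos_bound {m : ℝ → ℂ} (hm : Continuous m) (T : ℝ) :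
    ∃ M, 0 < M ∧ ∀ t ∈ Icc 0 T, ‖m t‖ ≤ M := by
  obtain ⟨C, hC⟩ := isCompact_Icc.exists_bound_of_continuousOn (s := Icc 0 T) hm.continuousOn
  exact ⟨max C 1, by positivity, fun t ht => (hC t ht).trans (le_max_left _ _)⟩

theorem volterra_norm_le {m : ℝ → ℂ} {T M : ℝ} (hM : 0 < M) (hmM : ∀ t ∈ Icc 0 T, ‖m t‖ ≤ M)
    {f k : ℝ → ℂ} {K : ℝ} (hf : Continuous f)
    (hk : ∀ t ∈ Icc 0 T, ‖k t‖ ≤ K)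
    (h : ∀ t ∈ Icc 0 T, f t = k t - ∫ s in (0 : ℝ)..t, f (t - s) * m s) :
    ∀ t ∈ Icc 0 T, ‖f t‖ ≤ 2 * K * Real.exp (2 * M * T) := by
  refine norm_le_of_le_add_integral hf hM fun t ht => ?_
  rw [h t ht]
  refine (norm_sub_le _ _).trans (add_le_add (hk t ht) ?_)
  calc ‖∫ s in (0 : ℝ)..t, f (t - s) * m s‖
      ≤ ∫ s in (0 : ℝ)..t, ‖f (t - s)‖ * M := by
        apply intervalIntegral.norm_integral_le_of_norm_le ht.1
        · refine MeasureTheory.ae_of_all _ fun s hs => ?_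
          rw [norm_mul]
          gcongr
          exact hmM s ⟨hs.1.le, hs.2.trans ht.2⟩
        · exact (by fun_prop : Continuous fun s => ‖f (t - s)‖ * M).intervalIntegrable _ _
    _ = M * ∫ s in (0 : ℝ)..t, ‖f s‖ := by
        rw [intervalIntegral.integral_mul_const, mul_comm,
          intervalIntegral.integral_comp_sub_left (fun s => ‖f s‖)]
        simp

theorem volterra_unique {m k f g : ℝ → ℂ} (hm : Continuous m) (hf : Continuous f)
    (hg : Continuous g)
    (hfk : ∀ t, 0 ≤ t → f t = k t - ∫ s in (0 : ℝ)..t, f (t - s) * m s)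
    (hgk : ∀ t, 0 ≤ t → g t = k t - ∫ s in (0 : ℝ)..t, g (t - s) * m s) :
    ∀ t, 0 ≤ t → f t = g t := by
  intro t ht
  obtain ⟨M, hM, hmM⟩ := exists_pos_bound hm t
  have := volterra_norm_le (f := fun t => f t - g t) (k := fun _ => 0) (K := 0) hM hmM
    (hf.sub hg) (by simp) (fun r hr => by
      simp only [sub_mul]
      rw [intervalIntegral.integral_sub, hfk r hr.1, hgk r hr.1]
      · ring
      · exact (by fun_prop : Continuous fun s => f (r - s) * m s).intervalIntegrable _ _
      · exact (by fun_prop : Continuous fun s => g (r - s) * m s).intervalIntegrable _ _)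
    t ⟨ht, le_rfl⟩
  simpa [sub_eq_zero] using this

/-- The Picard iterates of the Volterra equation `f t = k t - ∫₀ᵗ f (t - s) m s ds`. -/
noncomputable def volterraIterate (k m : ℝ → ℂ) : ℕ → ℝ → ℂ
  | 0 => k
  | n + 1 => fun t => -∫ s in (0 : ℝ)..t, volterraIterate k m n (t - s) * m s

theorem continuous_volterraIterate {k m : ℝ → ℂ} (hk : Continuous k) (hm : Continuous m) (n : ℕ) :
    Continuous (volterraIterate k m n) := by
  induction n with
  | zero => exact hk
  | succ n ih => exact (continuous_convolution ih hm).neg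

/-- The weight `exp (2Mt)` makes each convolution a contraction by `1/2`, since integrating it gains
`1 / (2M)` against the kernel bound `M`. The resulting geometric bound sums on every compact
interval, whatever its length. -/
theorem norm_volterraIterate_le {k m : ℝ → ℂ} {T K M : ℝ} (hM : 0 < M) (hkK : ∀ t ∈ Icc 0 T, ‖k t‖ ≤ K)
    (hmM : ∀ t ∈ Icc 0 T, ‖m t‖ ≤ M) (n : ℕ) :
    ∀ t ∈ Icc 0 T, ‖volterraIterate k m n t‖ ≤ K * (1 / 2) ^ n * Real.exp (2 * M * t) := by
  induction n with
  | zero =>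
    intro t ht
    have h1 : 1 ≤ Real.exp (2 * M * t) := Real.one_le_exp (by nlinarith [ht.1])
    have h2 := hkK t ht
    have h3 : 0 ≤ K := (norm_nonneg _).trans h2
    simp only [volterraIterate, pow_zero, mul_one]
    nlinarith
  | succ n ih =>
    intro t ht
    have hK : 0 ≤ K := (norm_nonneg _).trans (hkK t ht)
    simp only [volterraIterate, norm_neg]
    calc ‖∫ s in (0 : ℝ)..t, volterraIterate k m n (t - s) * m s‖
        ≤ ∫ s in (0 : ℝ)..t, K * (1 / 2) ^ n * Real.exp (2 * M * (t - s)) * M := by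
          apply intervalIntegral.norm_integral_le_of_norm_le ht.1
          · refine MeasureTheory.ae_of_all _ fun s hs => ?_
            rw [norm_mul]
            have hs' : t - s ∈ Icc 0 T := ⟨by linarith [hs.2], by linarith [hs.1, ht.2]⟩
            gcongr
            · exact ih _ hs'
            · exact hmM s ⟨hs.1.le, hs.2.trans ht.2⟩
          · exact (by fun_prop : Continuous fun s =>
              K * (1 / 2) ^ n * Real.exp (2 * M * (t - s)) * M).intervalIntegrable _ _
      _ = K * (1 / 2) ^ n * ((Real.exp (2 * M * t) - 1) / (2 * M)) * M := by
          rw [intervalIntegral.integral_mul_const, intervalIntegral.integral_const_mul,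
            intervalIntegral.integral_comp_sub_left (fun s => Real.exp (2 * M * s)),
            intervalIntegral.integral_comp_mul_left (fun s => Real.exp s) (by positivity)]
          simp [integral_exp, div_eq_inv_mul]
      _ ≤ K * (1 / 2) ^ n * (Real.exp (2 * M * t) / (2 * M)) * M := by gcongr; linarith
      _ = _ := by rw [pow_succ]; field_simp

theorem exists_volterra_solution {k m : ℝ → ℂ} (hk : Continuous k) (hm : Continuous m) :
    ∃ f : ℝ → ℂ, ContinuousOn f (Ici 0) ∧
      ∀ t, 0 ≤ t → f t = k t - ∫ s in (0 : ℝ)..t, f (t - s) * m s := by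
  have key : ∀ T, ∃ C, ∀ n, ∀ t ∈ Icc 0 T, ‖volterraIterate k m n t‖ ≤ C * (1 / 2) ^ n := by
    intro T
    obtain ⟨M, hM, hmM⟩ := exists_pos_bound hm T
    obtain ⟨K, hK, hkK⟩ := exists_pos_bound hk T
    refine ⟨K * Real.exp (2 * M * T), fun n t ht => ?_⟩
    refine (norm_volterraIterate_le hM hkK hmM n t ht).trans ?_
    rw [mul_right_comm]
    gcongr
    exact ht.2
  have hgeom : ∀ C : ℝ, Summable fun n : ℕ => C * (1 / 2) ^ n := fun C =>
    (summable_geometric_of_lt_one (by norm_num) (by norm_num)).mul_left C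
  have hsum : ∀ t, 0 ≤ t → Summable fun n => volterraIterate k m n t := fun t ht => by
    obtain ⟨C, hC⟩ := key t
    exact .of_norm_bounded (hgeom C) fun n => hC n t ⟨ht, le_rfl⟩
  refine ⟨fun t => ∑' n, volterraIterate k m n t, ?_, fun t ht => ?_⟩
  · intro t ht
    -- Using `t + 1` makes `[0, t + 1]` a neighbourhood of `t` within `[0, ∞)`.
    obtain ⟨C, hC⟩ := key (t + 1)
    have h1 : ContinuousOn (fun t => ∑' n, volterraIterate k m n t) (Icc 0 (t + 1)) :=
      continuousOn_tsum (fun n => (continuous_volterraIterate hk hm n).continuousOn) (hgeom C) hC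
    refine (h1 t ⟨ht, by linarith⟩).mono_of_mem_nhdsWithin ?_
    rw [← Ici_inter_Iic]
    exact inter_mem_nhdsWithin _ (Iic_mem_nhds (by linarith))
  · obtain ⟨C, hC⟩ := key t
    obtain ⟨M, hM, hmM⟩ := exists_pos_bound hm t
    have hs : HasSum (fun n => ∫ s in (0 : ℝ)..t, volterraIterate k m n (t - s) * m s)
        (∫ s in (0 : ℝ)..t, (∑' n, volterraIterate k m n (t - s)) * m s) := by
      apply intervalIntegral.hasSum_integral_of_dominated_convergence
        (bound := fun n _ => C * (1 / 2) ^ n * M)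
      · intro n
        have := continuous_volterraIterate hk hm n
        exact (by fun_prop : Continuous fun s =>
          volterraIterate k m n (t - s) * m s).aestronglyMeasurable
      · refine fun n => MeasureTheory.ae_of_all _ fun s hs => ?_
        rw [uIoc_of_le ht] at hs
        rw [norm_mul]
        have h1 := hC n (t - s) ⟨by linarith [hs.2], by linarith [hs.1]⟩
        gcongr
        · exact (norm_nonneg _).trans h1
        · exact hmM s ⟨hs.1.le, hs.2⟩
      · exact MeasureTheory.ae_of_all _ fun s _ => (hgeom C).mul_right M
      · simp
      · refine MeasureTheory.ae_of_all _ fun s hs => ?_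
        rw [uIoc_of_le ht] at hs
        exact (hsum (t - s) (by linarith [hs.2])).hasSum.mul_right _
    change ∑' n, volterraIterate k m n t = _
    rw [(hsum t ht).tsum_eq_zero_add]
    have h2 := hs.neg.tsum_eq
    simp only [volterraIterate, h2]
    ring

end Volterra

end Mori

namespace Mori

variable {H : Type*} [NormedAddCommGroup H] [InnerProductSpace ℂ H]

/-! ### Generators of C0-semigroups: integral characterization, closedness, density. -/

section Semigroup

variable {U : ℝ → H →L[ℂ] H}

theorem IsC0Semigroup.apply_add (hU : IsC0Semigroup U) {s t : ℝ} (hs : 0 ≤ s) (ht : 0 ≤ t)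
    (x : H) : U (s + t) x = U s (U t x) := by
  rw [hU.map_add s t hs ht]
  rfl

theorem exists_norm_bound [CompleteSpace H] (hc : ∀ x, Continuous fun t => U t x) (T : ℝ) :
    ∃ C, 0 < C ∧ ∀ t ∈ Icc 0 T, ‖U t‖ ≤ C := by
  obtain ⟨C, hC⟩ := banach_steinhaus (g := fun t : Icc (0 : ℝ) T => U t) fun x => by
    obtain ⟨C, hC⟩ := isCompact_Icc.exists_bound_of_continuousOn (s := Icc 0 T)
      (hc x).continuousOn
    exact ⟨C, fun t => hC t t.2⟩
  exact ⟨max C 1, by positivity, fun t ht => (hC ⟨t, ht⟩).trans (le_max_left _ _)⟩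

theorem mem_graph_generator {p : H × H} :
    p ∈ (generator U).graph ↔ HasGeneratorValue U p.1 p.2 := by
  rw [LinearPMap.mem_graph_iff]
  constructor
  · rintro ⟨x, hx, hy⟩
    have : HasGeneratorValue U x (generator U x) := x.2.choose_spec
    rwa [hx, hy] at this
  · intro h
    refine ⟨⟨p.1, p.2, h⟩, rfl, ?_⟩
    exact HasGeneratorValue.unique (Exists.choose_spec (⟨p.2, h⟩ : ∃ y, HasGeneratorValue U p.1 y)) h

theorem hasGeneratorValue_generator (x : (generator U).domain) :
    HasGeneratorValue U x (generator U x) := x.2.choose_spec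

theorem hasGeneratorValue_integral [CompleteSpace H] (hU : IsC0Semigroup U)
    (hc : ∀ x, Continuous fun t => U t x) {t : ℝ} (ht : 0 ≤ t) (x : H) :
    HasGeneratorValue U (∫ s in (0 : ℝ)..t, U s x) (U t x - x) := by
  have h1 : Continuous (Function.uncurry fun _ s : ℝ => U (t + s) x - U s x) :=
    (((hc x).comp (by fun_prop : Continuous fun s : ℝ => t + s)).sub (hc x)).comp continuous_snd
  have h2 := tendsto_average h1
  simp only [add_zero, hU.map_zero, one_apply_eq_self] at h2
  refine h2.congr' ?_
  filter_upwards [self_mem_nhdsWithin] with h hh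
  have hi : ∀ a b, IntervalIntegrable (fun s => U s x) MeasureTheory.volume a b := fun a b =>
    (hc x).intervalIntegrable a b
  congr 1
  rw [← (U h).intervalIntegral_comp_comm (hi _ _),
    intervalIntegral.integral_sub _ (hi _ _),
    intervalIntegral.integral_comp_add_left (fun s => U s x)]
  · have h3 : ∫ s in (0 : ℝ)..t, U h (U s x) = ∫ s in (0 : ℝ)..t, U (h + s) x := by
      apply intervalIntegral.integral_congr
      intro s hs
      rw [uIcc_of_le ht] at hs
      exact (hU.apply_add (le_of_lt hh) hs.1 x).symm
    rw [h3, intervalIntegral.integral_comp_add_left (fun s => U s x)]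
    have e1 := intervalIntegral.integral_add_adjacent_intervals (hi 0 t) (hi t (t + h))
    have e2 := intervalIntegral.integral_add_adjacent_intervals (hi 0 h) (hi h (h + t))
    rw [add_zero, add_zero, sub_eq_sub_iff_add_eq_add, add_comm, e1,
      add_comm (∫ s in h..(h + t), U s x), e2, add_comm h t]
  · exact ((hc x).comp (by fun_prop : Continuous fun s : ℝ => t + s)).intervalIntegrable _ _

theorem HasGeneratorValue.sub_eq_integral [CompleteSpace H] (hU : IsC0Semigroup U)
    (hc : ∀ x, Continuous fun t => U t x) {x y : H} (h : HasGeneratorValue U x y)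
    {t : ℝ} (ht : 0 ≤ t) : U t x - x = ∫ s in (0 : ℝ)..t, U s y := by
  -- The semigroup law yields only a right derivative, which suffices for the fundamental theorem of
  -- calculus for continuous functions.
  have hd : ∀ r ∈ Ioo 0 t, HasDerivWithinAt (fun t => U t x) (U r y) (Ioi r) r := by
    intro r hr
    rw [hasDerivWithinAt_iff_tendsto_slope' self_notMem_Ioi]
    have h1 : Tendsto (fun s : ℝ => s - r) (𝓝[>] r) (𝓝[>] 0) := by
      refine tendsto_nhdsWithin_iff.2 ⟨?_, ?_⟩
      · have : Tendsto (fun s : ℝ => s - r) (𝓝 r) (𝓝 (r - r)) := tendsto_id.sub_const r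
        rw [sub_self] at this
        exact this.mono_left nhdsWithin_le_nhds
      · filter_upwards [self_mem_nhdsWithin] with s hs
        exact sub_pos.2 (mem_Ioi.1 hs)
    have h2 := ((U r).continuous.tendsto y).comp (Tendsto.comp h h1)
    refine h2.congr' ?_
    filter_upwards [self_mem_nhdsWithin] with s hs
    have h3 : U s x = U r (U (s - r) x) := by
      rw [← hU.apply_add hr.1.le (sub_pos.2 (mem_Ioi.1 hs)).le, add_sub_cancel]
    simp only [Function.comp_apply, slope, vsub_eq_sub, map_smul, map_sub, ← h3]
    rw [RCLike.real_smul_eq_coe_smul (K := ℂ), ← Complex.ofReal_inv]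
    rfl
  have := intervalIntegral.integral_eq_sub_of_hasDeriv_right_of_le ht (hc x).continuousOn hd
    ((hc y).intervalIntegrable _ _)
  rw [this, hU.map_zero]
  rfl

/-- Trades a limit for equations that are continuous in `(x, y)`, so the graph of the generator
becomes an intersection of closed sets. -/
theorem hasGeneratorValue_iff_forall_sub_eq_integral [CompleteSpace H] (hU : IsC0Semigroup U)
    (hc : ∀ x, Continuous fun t => U t x) {x y : H} :
    HasGeneratorValue U x y ↔ ∀ t, 0 ≤ t → U t x - x = ∫ s in (0 : ℝ)..t, U s y := by
  refine ⟨fun h t ht => h.sub_eq_integral hU hc ht, fun h => ?_⟩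
  have h1 := tendsto_average (Φ := fun _ s => U s y) ((hc y).comp continuous_snd)
  simp only [hU.map_zero, one_apply_eq_self] at h1
  refine h1.congr' ?_
  filter_upwards [self_mem_nhdsWithin] with r hr
  rw [h r (le_of_lt hr)]

theorem continuous_integral_apply [CompleteSpace H]
    (hc : ∀ x, Continuous fun t => U t x) {t : ℝ} (ht : 0 ≤ t) :
    Continuous fun x => ∫ s in (0 : ℝ)..t, U s x := by
  obtain ⟨C, -, hC⟩ := exists_norm_bound hc t
  have hi : ∀ x, IntervalIntegrable (fun s => U s x) MeasureTheory.volume 0 t := fun x =>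
    (hc x).intervalIntegrable 0 t
  let J : H →ₗ[ℂ] H :=
    { toFun := fun x => ∫ s in (0 : ℝ)..t, U s x
      map_add' := fun x y => by
        simp only [map_add]
        exact intervalIntegral.integral_add (hi x) (hi y)
      map_smul' := fun c x => by
        simp_rw [map_smul]
        exact intervalIntegral.integral_smul c _ }
  refine (J.mkContinuous (C * t) fun x => ?_).continuous
  have := intervalIntegral.norm_integral_le_of_norm_le_const (a := 0) (b := t)
    (f := fun s => U s x) (C := C * ‖x‖) fun s hs => by
      rw [uIoc_of_le ht] at hs
      exact (U s).le_of_opNorm_le (hC s ⟨hs.1.le, hs.2⟩) x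
  rw [sub_zero, abs_of_nonneg ht] at this
  rw [mul_right_comm]
  exact this

theorem isClosed_generator [CompleteSpace H] (hU : IsC0Semigroup U)
    (hc : ∀ x, Continuous fun t => U t x) : (generator U).IsClosed := by
  have : ((generator U).graph : Set (H × H)) =
      ⋂ t ∈ Ici (0 : ℝ), {p | U t p.1 - p.1 = ∫ s in (0 : ℝ)..t, U s p.2} := by
    ext p
    simp only [SetLike.mem_coe, mem_graph_generator,
      hasGeneratorValue_iff_forall_sub_eq_integral hU hc, mem_iInter, mem_Ici, mem_ofPred_eq]
  rw [LinearPMap.IsClosed, this]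
  refine isClosed_biInter fun t ht => isClosed_eq (by fun_prop) ?_
  exact (continuous_integral_apply hc ht).comp continuous_snd

theorem dense_domain_generator [CompleteSpace H] (hU : IsC0Semigroup U)
    (hc : ∀ x, Continuous fun t => U t x) : Dense ((generator U).domain : Set H) := by
  intro x
  have h1 := tendsto_average (Φ := fun _ s => U s x) ((hc x).comp continuous_snd)
  simp only [hU.map_zero, one_apply_eq_self] at h1
  refine mem_closure_of_tendsto h1 ?_
  filter_upwards [self_mem_nhdsWithin] with h hh
  exact (generator U).domain.smul_mem _
    ⟨_, hasGeneratorValue_integral hU hc (le_of_lt hh) x⟩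

end Semigroup

/-! ### Rank-one perturbation of a generator. -/

section Perturbation

variable [CompleteSpace H] {U : ℝ → H →L[ℂ] H}

/-- The semigroup generated by `L - B`, where `L` is the generator of `U` and `B` is the rank one
operator `x ↦ ⟪w, x⟫ z`. -/
theorem exists_rankOne_perturbation (hU : IsC0Semigroup U)
    (hc : ∀ x, Continuous fun t => U t x) (z w : H) (f : H → ℝ → ℂ) (hf : ∀ x, Continuous (f x))
    (hfV : ∀ x, ∀ t, 0 ≤ t → f x t = inner ℂ w (U t x)
      - ∫ s in (0 : ℝ)..t, f x (t - s) * inner ℂ w (U s z)) :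
    ∃ V : ℝ → H →L[ℂ] H,
      (∀ t, 0 ≤ t → ∀ x, V t x = U t x - ∫ s in (0 : ℝ)..t, f x (t - s) • U s z) ∧
      IsC0Semigroup V ∧ (∀ x, Continuous fun t => V t x) ∧
      ∀ x y, HasGeneratorValue V x y ↔ HasGeneratorValue U x (y + (inner ℂ w x : ℂ) • z) := by
  have hm : Continuous fun t => (inner ℂ w (U t z) : ℂ) := continuous_const.inner (hc z)
  have hcs : ∀ t : ℝ, Continuous fun s : ℝ => t - s := fun t => by fun_prop
  have hi1 : ∀ x t a b, IntervalIntegrable (fun s => f x (t - s) * inner ℂ w (U s z))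
      MeasureTheory.volume a b := fun x t a b =>
    (((hf x).comp (hcs t)).mul hm).intervalIntegrable a b
  have hi2 : ∀ x t a b, IntervalIntegrable (fun s => f x (t - s) • U s z)
      MeasureTheory.volume a b := fun x t a b =>
    (((hf x).comp (hcs t)).smul (hc z)).intervalIntegrable a b
  have hadd : ∀ x y t, 0 ≤ t → f (x + y) t = f x t + f y t := by
    intro x y
    refine volterra_unique hm (hf _) ((hf x).add (hf y)) (hfV (x + y)) fun t ht => ?_
    simp only [add_mul]
    rw [intervalIntegral.integral_add (hi1 _ _ _ _) (hi1 _ _ _ _), hfV x t ht, hfV y t ht,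
      map_add, inner_add_right]
    ring
  have hsmul : ∀ (c : ℂ) x t, 0 ≤ t → f (c • x) t = c * f x t := by
    intro c x
    refine volterra_unique hm (hf _) (continuous_const.mul (hf x)) (hfV (c • x)) fun t ht => ?_
    simp only [mul_assoc]
    rw [intervalIntegral.integral_const_mul, hfV x t ht, map_smul, inner_smul_right]
    ring
  have hbound : ∀ T, 0 ≤ T → ∃ C, 0 < C ∧ ∀ x, ∀ t ∈ Icc 0 T, ‖f x t‖ ≤ C * ‖x‖ := by
    intro T hT
    obtain ⟨M, hM, hmM⟩ := exists_pos_bound hm T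
    obtain ⟨C, hC0, hC⟩ := exists_norm_bound hc T
    refine ⟨2 * ((‖w‖ + 1) * C) * Real.exp (2 * M * T), by positivity, fun x t ht => ?_⟩
    refine (volterra_norm_le (k := fun t => inner ℂ w (U t x)) (K := (‖w‖ + 1) * C * ‖x‖)
      hM hmM (hf x) (fun s hs => ?_) (fun s hs => hfV x s hs.1) t ht).trans (by
        apply le_of_eq; ring)
    refine (norm_inner_le_norm _ _).trans ?_
    have := (U s).le_of_opNorm_le (hC s hs) x
    rw [mul_assoc]
    gcongr
    linarith
  have hf0 : ∀ x, f x 0 = inner ℂ w x := fun x => by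
    rw [hfV x 0 le_rfl, hU.map_zero]
    simp
  -- Duhamel's formula, with `f x t` in the role of `⟨w, V t x⟩`; pairing it with `w` recovers the
  -- Volterra equation.
  let V0 : ℝ → H → H := fun t x => U t x - ∫ s in (0 : ℝ)..t, f x (t - s) • U s z
  have hV0c : ∀ x, Continuous fun t => V0 t x := fun x =>
    (hc x).sub (continuous_convolution (hf x) (hc z))
  have hV : ∀ t, 0 ≤ t → ∃ A : H →L[ℂ] H, ∀ x, A x = V0 t x := by
    intro t ht
    obtain ⟨C, hC0, hC⟩ := hbound t ht
    obtain ⟨N, hN0, hN⟩ := exists_norm_bound hc t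
    refine ⟨LinearMap.mkContinuous
      { toFun := V0 t
        map_add' := fun x y => ?_
        map_smul' := fun c x => ?_ } (N + C * (N * ‖z‖) * t) fun x => ?_, fun x => rfl⟩
    · have : ∫ s in (0 : ℝ)..t, f (x + y) (t - s) • U s z
          = ∫ s in (0 : ℝ)..t, (f x (t - s) • U s z + f y (t - s) • U s z) := by
        refine intervalIntegral.integral_congr fun s hs => ?_
        rw [uIcc_of_le ht] at hs
        simp only [hadd x y (t - s) (sub_nonneg.2 hs.2), add_smul]
      simp only [V0]
      rw [this, intervalIntegral.integral_add (hi2 _ _ _ _) (hi2 _ _ _ _), map_add]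
      abel
    · have : ∫ s in (0 : ℝ)..t, f (c • x) (t - s) • U s z
          = ∫ s in (0 : ℝ)..t, c • (f x (t - s) • U s z) := by
        refine intervalIntegral.integral_congr fun s hs => ?_
        rw [uIcc_of_le ht] at hs
        simp only [hsmul c x (t - s) (sub_nonneg.2 hs.2), mul_smul]
      simp only [V0]
      rw [this, intervalIntegral.integral_smul, map_smul, ← smul_sub, RingHom.id_apply]
    · have h1 := (U t).le_of_opNorm_le (hN t ⟨ht, le_rfl⟩) x
      have h2 := intervalIntegral.norm_integral_le_of_norm_le_const (a := 0) (b := t)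
        (f := fun s => f x (t - s) • U s z) (C := C * ‖x‖ * (N * ‖z‖)) fun s hs => by
          rw [uIoc_of_le ht] at hs
          rw [norm_smul]
          gcongr
          · exact hC x (t - s) ⟨by linarith [hs.2], by linarith [hs.1]⟩
          · exact (U s).le_of_opNorm_le (hN s ⟨hs.1.le, hs.2⟩) z
      rw [sub_zero, abs_of_nonneg ht] at h2
      calc ‖V0 t x‖ ≤ N * ‖x‖ + C * ‖x‖ * (N * ‖z‖) * t :=
            (norm_sub_le _ _).trans (add_le_add h1 h2)
        _ = _ := by ring
  choose V hV' using fun t : ℝ => hV (max t 0) (le_max_right _ _)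
  have hVV : ∀ t, 0 ≤ t → ∀ x, V t x = V0 t x := fun t ht x => by rw [hV', max_eq_left ht]
  have hVc : ∀ x, Continuous fun t => V t x := fun x => by
    simp only [hV']
    exact (hV0c x).comp (continuous_id.max continuous_const)
  -- splitting of the convolution, used both for `f` and for `V`
  have hsplit : ∀ {s t : ℝ}, 0 ≤ s → 0 ≤ t → ∀ x,
      U (t + s) x - ∫ r in (0 : ℝ)..(t + s), f x (t + s - r) • U r z
        = U t (V0 s x) - ∫ r in (0 : ℝ)..t, f x (t + s - r) • U r z := by
    intro s t hs ht x
    rw [← intervalIntegral.integral_add_adjacent_intervals (hi2 x (t + s) 0 t)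
      (hi2 x (t + s) t (t + s))]
    have h1 : ∫ r in t..(t + s), f x (t + s - r) • U r z
        = U t (∫ r in (0 : ℝ)..s, f x (s - r) • U r z) := by
      rw [← (U t).intervalIntegral_comp_comm (hi2 _ _ _ _)]
      have h2 := intervalIntegral.integral_comp_add_left (a := 0) (b := s)
        (fun r => f x (t + s - r) • U r z) t
      rw [add_zero] at h2
      rw [← h2]
      refine intervalIntegral.integral_congr fun r hr => ?_
      rw [uIcc_of_le hs] at hr
      simp only [map_smul, hU.apply_add ht hr.1, add_sub_add_left_eq_sub]
    rw [h1, hU.apply_add ht hs]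
    simp only [V0, map_sub]
    abel
  have hinner : ∀ x t T a b, (inner ℂ w (U t x - ∫ s in a..b, f x (T - s) • U s z) : ℂ)
      = inner ℂ w (U t x) - ∫ s in a..b, f x (T - s) * inner ℂ w (U s z) := by
    intro x t T a b
    rw [inner_sub_right]
    congr 1
    have := (innerSL ℂ w).intervalIntegral_comp_comm (hi2 x T a b)
    simp only [innerSL_apply_apply, inner_smul_right] at this
    exact this.symm
  -- The cocycle law of `f`: by `hsplit` paired with `w`, the shifted function solves the Volterra
  -- equation started from `V0 s x`, so uniqueness applies. The semigroup law of `V` then follows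
  -- from `hsplit`.
  have hshift : ∀ {s : ℝ}, 0 ≤ s → ∀ x t, 0 ≤ t → f (V0 s x) t = f x (t + s) := by
    intro s hs x
    refine volterra_unique (k := fun t => inner ℂ w (U t (V0 s x))) hm (hf _)
      ((hf x).comp (by fun_prop : Continuous fun t : ℝ => t + s)) (hfV _) fun t ht => ?_
    have h1 := hfV x (t + s) (add_nonneg ht hs)
    rw [← hinner, hsplit hs ht, inner_sub_right] at h1
    rw [h1]
    congr 1
    have := (innerSL ℂ w).intervalIntegral_comp_comm (hi2 x (t + s) 0 t)
    simp only [innerSL_apply_apply, inner_smul_right] at this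
    rw [← this]
    refine intervalIntegral.integral_congr fun r _ => ?_
    simp only [sub_add_eq_add_sub]
  refine ⟨V, hVV, ⟨?_, ?_, fun x => (hVc x).continuousOn⟩, hVc, ?_⟩
  · ext x
    rw [hVV 0 le_rfl]
    simp [V0, hU.map_zero]
  · intro s t hs ht
    ext x
    rw [mul_apply_eq_comp, hVV t ht, hVV s hs, hVV _ (add_nonneg hs ht)]
    change U (s + t) x - ∫ r in (0 : ℝ)..(s + t), f x (s + t - r) • U r z = _
    rw [hsplit ht hs]
    simp only [V0]
    congr 1
    refine intervalIntegral.integral_congr fun r hr => ?_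
    rw [uIcc_of_le hs] at hr
    have := hshift ht x (s - r) (sub_nonneg.2 hr.2)
    simp only [V0] at this
    simp only [this, sub_add_eq_add_sub]
  · intro x y
    -- The Duhamel term divided by `h` tends to `f x 0 • z = ⟨w, x⟩ z` for every `x`, so the
    -- difference quotients of `U` and `V` converge simultaneously.
    have h1 := tendsto_average (Φ := fun t s => f x (t - s) • U s z) (by
      have h2 := hc z
      have h3 := hf x
      exact (h3.comp (by fun_prop : Continuous fun p : ℝ × ℝ => p.1 - p.2)).smul
        (h2.comp continuous_snd))
    simp only [sub_zero, hf0, hU.map_zero, one_apply_eq_self] at h1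
    have h2 : ∀ᶠ h : ℝ in 𝓝[>] 0, ((h : ℂ)⁻¹) • (V h x - x) = ((h : ℂ)⁻¹) • (U h x - x)
        - ((h : ℂ)⁻¹) • ∫ s in (0 : ℝ)..h, f x (h - s) • U s z := by
      filter_upwards [self_mem_nhdsWithin] with h hh
      rw [hVV h (le_of_lt hh), ← smul_sub]
      congr 1
      simp only [V0]
      abel
    constructor
    · intro h
      refine (Tendsto.add h h1).congr' ?_
      filter_upwards [h2] with h hh
      rw [hh, sub_add_cancel]
    · intro h
      have := Tendsto.sub h h1
      rw [add_sub_cancel_right] at this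
      refine this.congr' ?_
      filter_upwards [h2] with h hh
      rw [hh]

end Perturbation

end Mori

namespace Mori

variable {H : Type*} [NormedAddCommGroup H] [InnerProductSpace ℂ H]

/-! ### Graphs of compositions with bounded operators. -/

section Composition

theorem mem_graph_precomp {A : H →ₗ.[ℂ] H} {B : H →L[ℂ] H} {p : H × H} :
    p ∈ (precomp A B).graph ↔ (B p.1, p.2) ∈ A.graph := by
  simp only [LinearPMap.mem_graph_iff]
  constructor
  · rintro ⟨x, hx, hy⟩
    exact ⟨⟨B x, x.2⟩, by rw [← hx], hy⟩
  · rintro ⟨⟨x, hxA⟩, hx, hy⟩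
    simp only at hx
    subst hx
    exact ⟨⟨p.1, hxA⟩, rfl, hy⟩

theorem mem_graph_postcomp {A : H →ₗ.[ℂ] H} {B : H →L[ℂ] H} {p : H × H} :
    p ∈ (postcomp B A).graph ↔ ∃ y, (p.1, y) ∈ A.graph ∧ B y = p.2 := by
  simp only [LinearPMap.mem_graph_iff]
  constructor
  · rintro ⟨x, hx, hy⟩
    exact ⟨A x, ⟨x, hx, rfl⟩, hy⟩
  · rintro ⟨_, ⟨x, hx, rfl⟩, hy⟩
    exact ⟨x, hx, hy⟩

theorem precomp_postcomp (A : H →ₗ.[ℂ] H) (B C : H →L[ℂ] H) :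
    precomp (postcomp C A) B = postcomp C (precomp A B) := rfl

theorem isClosed_precomp {A : H →ₗ.[ℂ] H} (hA : A.IsClosed) (B : H →L[ℂ] H) :
    (precomp A B).IsClosed := by
  have : ((precomp A B).graph : Set (H × H)) = (fun p => (B p.1, p.2)) ⁻¹' A.graph := by
    ext p
    exact mem_graph_precomp
  rw [LinearPMap.IsClosed, this]
  exact IsClosed.preimage (by fun_prop) hA

theorem closure_eq_self {A : H →ₗ.[ℂ] H} (hA : A.IsClosed) : A.closure = A := by
  apply LinearPMap.eq_of_eq_graph
  rw [← hA.isClosable.graph_closure_eq_closure_graph]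
  exact hA.submodule_topologicalClosure_eq

end Composition

/-! ### Algebra of the orthogonal projections `P` and `Q`. -/

section Projection

variable {z : H}

theorem P_apply (z x : H) : P z x = ((inner ℂ z z : ℂ)⁻¹ * inner ℂ z x) • z := by
  simp [P, mul_smul]

theorem Q_apply (z x : H) : Q z x = x - ((inner ℂ z z : ℂ)⁻¹ * inner ℂ z x) • z := by
  simp [Q, P_apply]

theorem P_add_Q (z x : H) : P z x + Q z x = x := by
  rw [P_apply, Q_apply, add_sub_cancel]

theorem inner_Q_right (hz : z ≠ 0) (x : H) : (inner ℂ z (Q z x) : ℂ) = 0 := by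
  have : (inner ℂ z z : ℂ) ≠ 0 := inner_self_ne_zero.2 hz
  rw [Q_apply, inner_sub_right, inner_smul_right]
  field_simp
  ring

theorem inner_Q_left (z w x : H) : (inner ℂ (Q z w) x : ℂ) = inner ℂ w (Q z x) := by
  rw [Q_apply, Q_apply, inner_sub_left, inner_sub_right, inner_smul_left, inner_smul_right,
    map_mul, map_inv₀, inner_conj_symm, inner_conj_symm]
  ring

theorem P_eq_zero_of_inner {x : H} (h : (inner ℂ z x : ℂ) = 0) : P z x = 0 := by
  rw [P_apply, h, mul_zero, zero_smul]

theorem Q_eq_self_of_inner {x : H} (h : (inner ℂ z x : ℂ) = 0) : Q z x = x := by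
  rw [Q_apply, h, mul_zero, zero_smul, sub_zero]

theorem Q_Q (hz : z ≠ 0) (x : H) : Q z (Q z x) = Q z x := Q_eq_self_of_inner (inner_Q_right hz x)

theorem Q_P (hz : z ≠ 0) (x : H) : Q z (P z x) = 0 := by
  have h := congrArg (Q z) (P_add_Q z x)
  rwa [map_add, Q_Q hz, add_eq_right] at h

theorem P_P (hz : z ≠ 0) (x : H) : P z (P z x) = P z x := by
  have h := P_add_Q z (P z x)
  rwa [Q_P hz, add_zero] at h

end Projection

/-! ### Passing from `[0, ∞)` to the whole line, so that global continuity is available. -/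

section Extension

/-- The extension of a function on `[0, ∞)` which is constant on `(-∞, 0]`. -/
def extendConst {α : Type*} (f : ℝ → α) : ℝ → α := fun t => f (max t 0)

theorem extendConst_of_nonneg {α : Type*} (f : ℝ → α) {t : ℝ} (ht : 0 ≤ t) :
    extendConst f t = f t := by
  rw [extendConst, max_eq_left ht]

theorem continuous_extendConst {α : Type*} [TopologicalSpace α] {f : ℝ → α}
    (hf : ContinuousOn f (Ici 0)) : Continuous (extendConst f) :=
  hf.comp_continuous (continuous_id.max continuous_const) fun t => mem_Ici.2 (le_max_right t 0)

variable {U : ℝ → H →L[ℂ] H}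

theorem IsC0Semigroup.continuous_extendConst (hU : IsC0Semigroup U) (x : H) :
    Continuous fun t => extendConst U t x :=
  Mori.continuous_extendConst (hU.continuousOn x)

theorem IsC0Semigroup.extendConst (hU : IsC0Semigroup U) : IsC0Semigroup (extendConst U) where
  map_zero := by rw [extendConst_of_nonneg U le_rfl, hU.map_zero]
  map_add s t hs ht := by
    rw [extendConst_of_nonneg U hs, extendConst_of_nonneg U ht,
      extendConst_of_nonneg U (add_nonneg hs ht), hU.map_add s t hs ht]
  continuousOn x := (hU.continuous_extendConst x).continuousOn

theorem hasGeneratorValue_congr {V : ℝ → H →L[ℂ] H} {x x' y : H}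
    (h : ∀ t, 0 ≤ t → U t x - x = V t x' - x') :
    HasGeneratorValue U x y ↔ HasGeneratorValue V x' y := by
  refine tendsto_congr' ?_
  filter_upwards [self_mem_nhdsWithin] with t ht
  rw [h t (le_of_lt ht)]

theorem generator_extendConst (U : ℝ → H →L[ℂ] H) : generator (extendConst U) = generator U := by
  apply LinearPMap.eq_of_eq_graph
  ext p
  rw [mem_graph_generator, mem_graph_generator]
  exact hasGeneratorValue_congr fun t ht => by rw [extendConst_of_nonneg U ht]

/-- The vector representing `y ↦ (y, Q w) (z, z)⁻¹`. -/
noncomputable def volterraVector (z w : H) : H := (inner ℂ z z : ℂ)⁻¹ • Q z w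

theorem inner_volterraVector (z w y : H) :
    (inner ℂ (volterraVector z w) y : ℂ) = inner ℂ (Q z w) y * (inner ℂ z z)⁻¹ := by
  rw [volterraVector, inner_smul_left, map_inv₀, inner_conj_symm, mul_comm]

theorem isVolterraSolution_iff {z w x : H} {f : ℝ → ℂ} :
    IsVolterraSolution U z w x f ↔ ContinuousOn f (Ici 0) ∧
      ∀ t, 0 ≤ t → f t = inner ℂ (volterraVector z w) (extendConst U t (Q z x))
        - ∫ s in (0 : ℝ)..t, f (t - s) * inner ℂ (volterraVector z w) (extendConst U s z) := by
  refine and_congr_right fun _ => forall₂_congr fun t ht => ?_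
  rw [extendConst_of_nonneg U ht, inner_volterraVector]
  have : ∫ s in (0 : ℝ)..t, f (t - s) * inner ℂ (volterraVector z w) (extendConst U s z)
      = ∫ s in (0 : ℝ)..t, f (t - s) * (inner ℂ (Q z w) (U s z) * (inner ℂ z z)⁻¹) := by
    refine intervalIntegral.integral_congr fun s hs => ?_
    rw [uIcc_of_le ht] at hs
    simp only [extendConst_of_nonneg U hs.1, inner_volterraVector]
  rw [this]

theorem volterra_extendConst {f k m : ℝ → ℂ}
    (h : ∀ t, 0 ≤ t → f t = k t - ∫ s in (0 : ℝ)..t, f (t - s) * m s) :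
    ∀ t, 0 ≤ t → extendConst f t = k t - ∫ s in (0 : ℝ)..t, extendConst f (t - s) * m s := by
  intro t ht
  rw [extendConst_of_nonneg f ht, h t ht]
  congr 1
  refine intervalIntegral.integral_congr fun s hs => ?_
  rw [uIcc_of_le ht] at hs
  simp only [extendConst_of_nonneg f (sub_nonneg.2 hs.2)]

end Extension

/-! ### The operators `QL` and `QLQ`, and the semigroup. -/

section Main

variable {U : ℝ → H →L[ℂ] H}

theorem IsC0Semigroup.exists_isVolterraSolution (hU : IsC0Semigroup U) (z w x : H) :
    ∃ f, IsVolterraSolution U z w x f := by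
  obtain ⟨f, hf, hfV⟩ := exists_volterra_solution
    (k := fun t => inner ℂ (volterraVector z w) (Mori.extendConst U t (Q z x)))
    (m := fun t => inner ℂ (volterraVector z w) (Mori.extendConst U t z))
    (continuous_const.inner (hU.continuous_extendConst _))
    (continuous_const.inner (hU.continuous_extendConst _))
  exact ⟨f, isVolterraSolution_iff.2 ⟨hf, hfV⟩⟩

theorem IsC0Semigroup.isVolterraSolution_unique (hU : IsC0Semigroup U) {z w x : H} {f g : ℝ → ℂ}
    (hf : IsVolterraSolution U z w x f) (hg : IsVolterraSolution U z w x g) :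
    EqOn f g (Ici 0) := by
  intro t ht
  rw [isVolterraSolution_iff] at hf hg
  have := volterra_unique
    (k := fun t => inner ℂ (volterraVector z w) (Mori.extendConst U t (Q z x)))
    (m := fun t => inner ℂ (volterraVector z w) (Mori.extendConst U t z))
    (continuous_const.inner (hU.continuous_extendConst _))
    (Mori.continuous_extendConst hf.1) (Mori.continuous_extendConst hg.1)
    (volterra_extendConst hf.2) (volterra_extendConst hg.2) t ht
  rwa [extendConst_of_nonneg f ht, extendConst_of_nonneg g ht] at this

theorem IsC0Semigroup.inner_eq_of_hasGeneratorValue [CompleteSpace H] (hU : IsC0Semigroup U)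
    {z : H} (hz : z ∈ (generator U).adjoint.domain) {x y : H} (h : HasGeneratorValue U x y) :
    (inner ℂ ((generator U).adjoint ⟨z, hz⟩) x : ℂ) = inner ℂ z y := by
  have hd : Dense ((generator U).domain : Set H) := by
    rw [← generator_extendConst U]
    exact dense_domain_generator hU.extendConst hU.continuous_extendConst
  have h1 := LinearPMap.adjoint_isFormalAdjoint hd ⟨z, hz⟩ ⟨x, y, h⟩
  rwa [(hasGeneratorValue_generator ⟨x, y, h⟩).unique h] at h1

variable {z w : H}

/-- The component of `Lx` along `z` is determined continuously by `x`, so `Lx` can be rebuilt from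
`QLx`. This removes the existential quantifier and exhibits the graph of `QL` as a closed set. -/
theorem exists_hasGeneratorValue_Q_eq_iff
    (hzw : ∀ x y, HasGeneratorValue U x y → (inner ℂ w x : ℂ) = inner ℂ z y) (hz0 : z ≠ 0)
    (x y : H) :
    (∃ y', HasGeneratorValue U x y' ∧ Q z y' = y) ↔
      HasGeneratorValue U x (y + ((inner ℂ z z : ℂ)⁻¹ * inner ℂ w x) • z) ∧
        (inner ℂ z y : ℂ) = 0 := by
  constructor
  · rintro ⟨y', h, rfl⟩
    rw [hzw _ _ h, Q_apply, sub_add_cancel, ← Q_apply]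
    exact ⟨h, inner_Q_right hz0 y'⟩
  · rintro ⟨h, hy⟩
    refine ⟨_, h, ?_⟩
    rw [hzw _ _ h, ← P_apply, map_add, Q_P hz0, add_zero, Q_eq_self_of_inner hy]

theorem isClosed_postcomp_Q [CompleteSpace H] (hU : IsC0Semigroup U)
    (hzw : ∀ x y, HasGeneratorValue U x y → (inner ℂ w x : ℂ) = inner ℂ z y) (hz0 : z ≠ 0) :
    (postcomp (Q z) (generator U)).IsClosed := by
  have hL : (generator U).IsClosed := by
    rw [← generator_extendConst U]
    exact isClosed_generator hU.extendConst hU.continuous_extendConst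
  have : ((postcomp (Q z) (generator U)).graph : Set (H × H)) =
      (fun p : H × H => (p.1, p.2 + ((inner ℂ z z : ℂ)⁻¹ * inner ℂ w p.1) • z)) ⁻¹'
        (generator U).graph ∩ {p | (inner ℂ z p.2 : ℂ) = 0} := by
    ext p
    simp only [SetLike.mem_coe, mem_graph_postcomp, mem_graph_generator, mem_inter_iff,
      mem_preimage]
    exact exists_hasGeneratorValue_Q_eq_iff hzw hz0 p.1 p.2
  rw [LinearPMap.IsClosed, this]
  refine (IsClosed.preimage ?_ hL).inter (isClosed_eq ?_ continuous_const)
  · fun_prop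
  · fun_prop

theorem exists_orbit_semigroup [CompleteSpace H] (hU : IsC0Semigroup U)
    (hzw : ∀ x y, HasGeneratorValue U x y → (inner ℂ w x : ℂ) = inner ℂ z y) (hz0 : z ≠ 0)
    (f : H → ℝ → ℂ) (hf : ∀ x, IsVolterraSolution U z w x (f x)) :
    ∃ G : ℝ → H →L[ℂ] H,
      (∀ t : ℝ, 0 ≤ t → ∀ x : H, G t x = orbit U z x (f x) t) ∧
      IsC0Semigroup G ∧
      generator G = precomp (postcomp (Q z) (generator U)) (Q z) := by
  have hc : (inner ℂ z z : ℂ) ≠ 0 := inner_self_ne_zero.2 hz0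
  -- Solutions are needed for every initial vector, not just those in `ran Q`, because `V` must act
  -- on all of `H`. The given `f x` is the solution started from `Q x`.
  have hex : ∀ x, ∃ f : ℝ → ℂ, Continuous f ∧
      ∀ t, 0 ≤ t → f t = inner ℂ (volterraVector z w) (extendConst U t x)
        - ∫ s in (0 : ℝ)..t, f (t - s) * inner ℂ (volterraVector z w) (extendConst U s z) := by
    intro x
    obtain ⟨f, hf, hfV⟩ := exists_volterra_solution
      (k := fun t => inner ℂ (volterraVector z w) (extendConst U t x))
      (m := fun t => inner ℂ (volterraVector z w) (extendConst U t z))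
      (continuous_const.inner (hU.continuous_extendConst _))
      (continuous_const.inner (hU.continuous_extendConst _))
    exact ⟨_, continuous_extendConst hf, volterra_extendConst hfV⟩
  choose f0 hf0 hf0V using hex
  obtain ⟨V, hV, hVs, hVc, hVgen⟩ := exists_rankOne_perturbation hU.extendConst
    hU.continuous_extendConst z (volterraVector z w) f0 hf0 hf0V
  have hgU : ∀ x y, HasGeneratorValue (extendConst U) x y ↔ HasGeneratorValue U x y := fun x y =>
    hasGeneratorValue_congr fun t ht => by rw [extendConst_of_nonneg U ht]
  have hff0 : ∀ x t, 0 ≤ t → f0 (Q z x) t = f x t := fun x t ht =>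
    hU.isVolterraSolution_unique
      (isVolterraSolution_iff.2 ⟨(hf0 _).continuousOn, hf0V (Q z x)⟩) (hf x) ht
  -- the range of `Q` is invariant
  have hinv : ∀ x t, 0 ≤ t → (inner ℂ z (V t (Q z x)) : ℂ) = 0 := by
    intro x
    have hφ : Continuous fun t => (inner ℂ z (V t (Q z x)) : ℂ) := continuous_const.inner (hVc _)
    -- Formally `φ' = ⟨w, v⟩ - ⟨w, Qv⟩ = ⟨w, Pv⟩ = (z,z)⁻¹⟨w, z⟩ φ` for `v = V t (Q z x)`, with `φ 0
    -- = 0`. In integrated form this is a homogeneous Volterra equation with constant kernel, and it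
    -- needs no differentiability of the orbit.
    refine volterra_unique (k := fun _ => 0)
      (m := fun _ => -((inner ℂ z z : ℂ)⁻¹ * inner ℂ w z))
      continuous_const hφ continuous_const (fun t ht => ?_) (by simp)
    have h1 := (hgU _ _).1 ((hVgen _ _).1 (hasGeneratorValue_integral hVs hVc ht (Q z x)))
    have h2 := hzw _ _ h1
    have h3 : ∫ s in (0 : ℝ)..t, (inner ℂ z (V s (Q z x)) : ℂ)
        = inner ℂ z (∫ s in (0 : ℝ)..t, V s (Q z x)) :=
      (innerSL ℂ z).intervalIntegral_comp_comm ((hVc _).intervalIntegrable 0 t)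
    rw [intervalIntegral.integral_mul_const,
      intervalIntegral.integral_comp_sub_left (fun s => (inner ℂ z (V s (Q z x)) : ℂ)),
      sub_self, sub_zero, h3]
    rw [inner_add_right, inner_sub_right, inner_Q_right hz0, inner_smul_right,
      inner_volterraVector, inner_Q_left, Q_apply z (∫ s in (0 : ℝ)..t, V s (Q z x)),
      inner_sub_right, inner_smul_right, inv_mul_cancel_right₀ hc] at h2
    linear_combination -h2
  have hQV : ∀ x t, 0 ≤ t → Q z (V t (Q z x)) = V t (Q z x) := fun x t ht =>
    Q_eq_self_of_inner (hinv x t ht)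
  have hG : ∀ t x, (P z + V t * Q z) x = P z x + V t (Q z x) := fun t x => rfl
  refine ⟨fun t => P z + V t * Q z, fun t ht x => ?_, ⟨?_, fun s t hs ht => ?_, fun x => ?_⟩, ?_⟩
  · rw [hG, hV t ht, orbit, extendConst_of_nonneg U ht, add_sub_assoc]
    congr 2
    refine intervalIntegral.integral_congr fun s hs => ?_
    rw [uIcc_of_le ht] at hs
    simp only [extendConst_of_nonneg U hs.1, hff0 x _ (sub_nonneg.2 hs.2)]
  · ext x
    rw [hG, hVs.map_zero]
    exact P_add_Q z x
  · ext x
    rw [mul_apply_eq_comp, hG, hG, hG, map_add, map_add, P_P hz0, Q_P hz0, zero_add, hQV x t ht,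
      P_eq_zero_of_inner (hinv x t ht), add_zero, hVs.apply_add hs ht]
  · exact (continuous_const.add (hVc (Q z x))).continuousOn
  · apply LinearPMap.eq_of_eq_graph
    ext ⟨x, y⟩
    rw [mem_graph_generator, mem_graph_precomp, mem_graph_postcomp]
    simp only [mem_graph_generator]
    rw [exists_hasGeneratorValue_Q_eq_iff hzw hz0]
    have h1 : HasGeneratorValue (fun t => P z + V t * Q z) x y ↔ HasGeneratorValue V (Q z x) y :=
      hasGeneratorValue_congr fun t _ => by
        rw [hG, ← add_sub_add_left_eq_sub (V t (Q z x)) (Q z x) (P z x), P_add_Q]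
    rw [h1, hVgen, hgU, inner_volterraVector, inner_Q_left, Q_Q hz0, mul_comm]
    -- Orthogonality of `y` to `z` is automatic: pairing the generator value with `z` gives `⟨w, Qx⟩
    -- = ⟨z, y⟩ + ⟨w, Qx⟩`.
    refine ⟨fun h => ⟨h, ?_⟩, fun h => h.1⟩
    have h2 := hzw _ _ h
    rw [inner_add_right, inner_smul_right, mul_right_comm, inv_mul_cancel₀ hc, one_mul] at h2
    exact right_eq_add.1 h2

end Main

end Mori

theorem mainTheorem2 {H : Type*} [NormedAddCommGroup H] [InnerProductSpace ℂ H] [CompleteSpace H]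
    (U : ℝ → H →L[ℂ] H) (hU : Mori.IsC0Semigroup U)
    (z : H) (hz0 : z ≠ 0) (hz : z ∈ (Mori.generator U).adjoint.domain) :
    -- the Volterra equation has a unique continuous solution on `[0, ∞)` for every `x`
    (∀ x : H, ∃ f : ℝ → ℂ,
      Mori.IsVolterraSolution U z ((Mori.generator U).adjoint ⟨z, hz⟩) x f ∧
      ∀ g : ℝ → ℂ, Mori.IsVolterraSolution U z ((Mori.generator U).adjoint ⟨z, hz⟩) x g →
        Set.EqOn g f (Set.Ici 0)) ∧
    -- `QL` is closable
    (Mori.postcomp (Mori.Q z) (Mori.generator U)).IsClosable ∧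
    -- the closure of `QL`, composed with `Q`, equals `QLQ`, which is closed
    Mori.precomp (Mori.postcomp (Mori.Q z) (Mori.generator U)).closure (Mori.Q z) =
      Mori.postcomp (Mori.Q z) (Mori.precomp (Mori.generator U) (Mori.Q z)) ∧
    (Mori.postcomp (Mori.Q z) (Mori.precomp (Mori.generator U) (Mori.Q z))).IsClosed ∧
    -- the family `u(·, t)` is a C0-semigroup generated by this operator
    ∀ f : H → ℝ → ℂ,
      (∀ x : H, Mori.IsVolterraSolution U z ((Mori.generator U).adjoint ⟨z, hz⟩) x (f x)) →
      ∃ G : ℝ → H →L[ℂ] H,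
        (∀ t : ℝ, 0 ≤ t → ∀ x : H, G t x = Mori.orbit U z x (f x) t) ∧
        Mori.IsC0Semigroup G ∧
        Mori.generator G =
          Mori.precomp (Mori.postcomp (Mori.Q z) (Mori.generator U)).closure (Mori.Q z) := by
  have hzw : ∀ x y, Mori.HasGeneratorValue U x y →
      (inner ℂ ((Mori.generator U).adjoint ⟨z, hz⟩) x : ℂ) = inner ℂ z y := fun x y h =>
    hU.inner_eq_of_hasGeneratorValue hz h
  have hQL := Mori.isClosed_postcomp_Q hU hzw hz0
  rw [Mori.closure_eq_self hQL, ← Mori.precomp_postcomp]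
  refine ⟨fun x => ?_, hQL.isClosable, rfl, Mori.isClosed_precomp hQL _,
    Mori.exists_orbit_semigroup hU hzw hz0⟩
  obtain ⟨f, hf⟩ := hU.exists_isVolterraSolution z ((Mori.generator U).adjoint ⟨z, hz⟩) x
  exact ⟨f, hf, fun g hg => hU.isVolterraSolution_unique hg hf⟩
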